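/- Let $n\in\mathbb N$. For $v\in\mathbb N^n$ write $v[i]$ for its $i$-th coordinate. A good semigroup $S\subseteq\mathbb N^n$ is a submonoid such that (i) $\min(a,b)\in S$ (coordinatewise minimum) for all $a,b\in S$; (ii) if $a,b\in S$ and $a[i]=b[i]$, there is $c\in S$ with $c[i]>a[i]$, $c[j]\ge\min(a[j],b[j])$ for all $j\ne i$, and $c[j]=\min(a[j],b[j])$ whenever $a[j]\neq b[j]$; (iii) $\delta+\mathbb N^n\subseteq S$ for some $\delta\in S$. It is local if $0$ is its only vector with a zero coordinate. It is an Arf semigroup if for every $\alpha\in S$ the set $\{\beta-\alpha:\beta\in S,\ \beta\ge\alpha\}$ is closed under addition. Let $G\subseteq\mathbb N^n$ and put $G[i]=\{g[i]:g\in G\}$. Consider the condition $(\ast)$ $\gcd(G[i])=1$ for every $i$, and for all $i<j$ there is $g\in G$ with $g[i]\ne g[j]$. **(1)** There is a smallest Arf semigroup $\mathrm{Arf}(G)$ of $\mathbb N^n$ containing $G$ (with respect to inclusion) if and only if $(\ast)$ holds. **(2)** Suppose that every nonzero vector of $G$ has all its coordinates positive (this is necessary for $G$ to be contained in a local semigroup).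 Then there is a smallest local Arf semigroup containing $G$ if and only if $(\ast)$ holds. **(3)** In the situation of (2), suppose that $(\ast)$ holds. Then $\mathrm{Arf}(G)$ is local, it is the smallest local Arf semigroup containing $G$, and it is computed as follows. *Multiplicity sequences.* For each $i$ let $m_{i,1},m_{i,2},\dots$ be the output of Du Val's algorithm on $I_1=G[i]$: $m_{i,j}$ is the smallest positive element of $I_j$, and $I_{j+1}=\{m_{i,j}\}\cup\{x-m_{i,j}:x\in I_j,\ x>0\}$. Then there is a smallest Arf numerical semigroup containing $G[i]$, and $(m_{i,j})_{j\ge1}$ is its multiplicity sequence, i.e. the sequence of differences of its consecutive elements. Let $E$ be the collection of these $n$ sequences. *Gluing matrix.* Let $s_{i,k}$ be the integer $s\ge k+1$ with $m_{i,k}=\sum_{t=k+1}^{s}m_{i,t}$, let $k_E(i,j)=\min\{\min(s_{i,k},s_{j,k}):s_{i,k}\ne s_{j,k}\}$ ($+\infty$ if there is no such $k$), and for $h\in G[i]$ let $\mathrm{pos}_E(i,h)$ be the integer $p$ with $h=\sum_{k=1}^{p}m_{i,k}$. Let $$U_E(G)=\{(i,j): i<j,\ \mathrm{pos}_E(i,g[i])=\mathrm{pos}_E(j,g[j])\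 \text{for all } g\in G\}$$ and, for $i<j$ with $(i,j)\notin U_E(G)$, let $\mathrm{MIN}_E(i,j,G)$ be the minimum of $k_E(i,j)$ and of all the numbers $\min(\mathrm{pos}_E(i,g[i]),\mathrm{pos}_E(j,g[j]))$ with $g\in G$ and $\mathrm{pos}_E(i,g[i])\ne\mathrm{pos}_E(j,g[j])$. Put $p_{i,j}=k_E(i,j)$ if $(i,j)\in U_E(G)$ and $p_{i,j}=\mathrm{MIN}_E(i,j,G)$ otherwise. All $p_{i,j}$ $(i<j)$ are finite. *The semigroup.* A multiplicity tree is a rooted tree with $n$ infinite branches, all passing through the root (level $1$), whose nodes are vectors of $\mathbb N^n$, where $\mathbf n_i^j$ is the node of the $i$-th branch at level $j$, such that: $\mathbf n_i^j$ is the $i$-th unit vector for all $i$ and all large $j$; $\mathbf n_i^j[h]=0$ if and only if $\mathbf n_i^j$ is not on the $h$-th branch; and each node is the sum of the other nodes of some finite subtree rooted in it. There is a multiplicity tree $T$ such that $\mathbf n_i^j[i]=m_{i,j}$ for all $i,j$ and such that, for $i<j$, $p_{i,j}$ is the highest level at which the $i$-th and $j$-th branches are glued (pass through the same node), and $$\mathrm{Arf}(G)=\{0\}\cup\Big\{\sum_{\mathbf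 n\in T'}\mathbf n\ :\ T'\text{ a finite subtree of }T\text{ containing the root of }T\Big\}.$$ -/

import Mathlib

/-! ### Good semigroups and Arf semigroups of `ℕⁿ` -/

/-- A good semigroup of `ℕⁿ`: a submonoid closed under coordinatewise minimum, with the exchange
property for two vectors having a common coordinate, and with a conductor. -/
structure IsGood {n : ℕ} (S : AddSubmonoid (Fin n → ℕ)) : Prop where
  inf_mem : ∀ a ∈ S, ∀ b ∈ S, a ⊓ b ∈ S
  exchange : ∀ a ∈ S, ∀ b ∈ S, ∀ i, a i = b i →
    ∃ c ∈ S, a i < c i ∧ ∀ j, j ≠ i →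
      min (a j) (b j) ≤ c j ∧ (a j ≠ b j → c j = min (a j) (b j))
  conductor : ∃ δ ∈ S, ∀ x, δ + x ∈ S

/-- An Arf semigroup of `ℕⁿ`: a good semigroup `S` such that, for every `α ∈ S`, the set
`S(α) - α = {x | α + x ∈ S}` is closed under addition. -/
structure IsArf {n : ℕ} (S : AddSubmonoid (Fin n → ℕ)) : Prop extends IsGood S where
  arf : ∀ α ∈ S, ∀ x y, α + x ∈ S → α + y ∈ S → α + (x + y) ∈ S

/-- `S` is local: the zero vector is the only vector of `S` with a zero coordinate. -/
def IsLocalSemigroup {n : ℕ} (S : AddSubmonoid (Fin n → ℕ)) : Prop :=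
  ∀ x ∈ S, (∃ i, x i = 0) → x = 0

/-- The Arf semigroups of `ℕⁿ` containing `G`. -/
def arfOver {n : ℕ} (G : Set (Fin n → ℕ)) : Set (AddSubmonoid (Fin n → ℕ)) :=
  {S | IsArf S ∧ G ⊆ (S : Set (Fin n → ℕ))}

/-- The local Arf semigroups of `ℕⁿ` containing `G`. -/
def localArfOver {n : ℕ} (G : Set (Fin n → ℕ)) : Set (AddSubmonoid (Fin n → ℕ)) :=
  {S | IsArf S ∧ IsLocalSemigroup S ∧ G ⊆ (S : Set (Fin n → ℕ))}

/-- The set `G[i]` of the `i`-th coordinates of the vectors of `G`. -/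
def coords {n : ℕ} (G : Set (Fin n → ℕ)) (i : Fin n) : Set ℕ :=
  (fun g => g i) '' G

/-! ### Arf numerical semigroups, multiplicity sequences, Du Val's algorithm

Sequences are indexed from `0`: the term with index `t` is the one at level `t + 1`. -/

/-- An Arf numerical semigroup. -/
structure IsArfNumerical (A : AddSubmonoid ℕ) : Prop where
  cofinite : ((A : Set ℕ)ᶜ).Finite
  arf : ∀ α ∈ A, ∀ x y, α + x ∈ A → α + y ∈ A → α + (x + y) ∈ A

/-- The multiplicity sequence of a numerical semigroup `{s₀ = 0 < s₁ < s₂ < ...}`: the sequence of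
the differences `s_{t+1} - s_t`. -/
noncomputable def multSeq (A : AddSubmonoid ℕ) (t : ℕ) : ℕ :=
  Nat.nth (fun x => x ∈ A) (t + 1) - Nat.nth (fun x => x ∈ A) t

/-- The smallest positive element of a set of natural numbers (`0` if there is none). -/
noncomputable def minPos (I : Set ℕ) : ℕ := sInf (I \ {0})

/-- One step of Du Val's algorithm: keep the smallest positive element of `I`, and subtract it from
the positive elements of `I`. -/
noncomputable def duValStep (I : Set ℕ) : Set ℕ :=
  insert (minPos I) ((fun x => x - minPos I) '' (I \ {0}))

/-- The output of Du Val's algorithm: the sequence of the smallest positive elements of the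
successive sets. -/
noncomputable def duVal (I : Set ℕ) (t : ℕ) : ℕ := minPos (duValStep^[t] I)

/-! ### The integers `s_{i,j}`, `k_E(i,j)`, `pos_E`, the set `U_E(G)` and `MIN_E(i,j,G)` -/

/-- The last level `s` of the sum `m_j = m_{j+1} + ... + m_s`, for the level `j = t + 1`. -/
noncomputable def lastLevel (m : ℕ → ℕ) (t : ℕ) : ℕ :=
  sInf {s | t + 2 ≤ s ∧ m t = ∑ u ∈ Finset.Ico (t + 1) s, m u}

/-- `k_E(i,j)`: the minimum of `min (s_{i,k}) (s_{j,k})` over the `k` with `s_{i,k} ≠ s_{j,k}`,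
and `+∞` if there is no such `k`. -/
noncomputable def kE {n : ℕ} (E : Fin n → ℕ → ℕ) (i j : Fin n) : ℕ∞ :=
  ⨅ (t : ℕ) (_ : lastLevel (E i) t ≠ lastLevel (E j) t),
    ((min (lastLevel (E i) t) (lastLevel (E j) t) : ℕ) : ℕ∞)

/-- `pos_E(i,h)`: the number of initial terms of the `i`-th sequence whose sum is `h`. -/
noncomputable def posE {n : ℕ} (E : Fin n → ℕ → ℕ) (i : Fin n) (h : ℕ) : ℕ :=
  sInf {p | h = ∑ k ∈ Finset.range p, E i k}

/-- `U_E(G)`. -/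
def UE {n : ℕ} (E : Fin n → ℕ → ℕ) (G : Set (Fin n → ℕ)) : Set (Fin n × Fin n) :=
  {q | q.1 < q.2 ∧ ∀ g ∈ G, posE E q.1 (g q.1) = posE E q.2 (g q.2)}

/-- `MIN_E(i,j,G)`. -/
noncomputable def MINE {n : ℕ} (E : Fin n → ℕ → ℕ) (i j : Fin n) (G : Set (Fin n → ℕ)) : ℕ∞ :=
  min (kE E i j)
    (⨅ (g : Fin n → ℕ) (_ : g ∈ G ∧ posE E i (g i) ≠ posE E j (g j)),
      ((min (posE E i (g i)) (posE E j (g j)) : ℕ) : ℕ∞))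

open Classical in
/-- The entry `p_{i,j}`, `i < j`, of the gluing matrix computed from `E` and `G`. -/
noncomputable def gluingEntry {n : ℕ} (E : Fin n → ℕ → ℕ) (G : Set (Fin n → ℕ)) (i j : Fin n) :
    ℕ∞ :=
  if (i, j) ∈ UE E G then kE E i j else MINE E i j G

/-! ### Multiplicity trees -/

/-- A rooted tree with `n` infinite branches whose nodes are vectors of `ℕⁿ`. The relation
`glue t` says which branches pass through the same node at level `t + 1`; branches glued at a level
are glued at all lower levels, and all of them are glued at the root. The nodes at level `t + 1`
are the classes of `glue t`, and `vec` gives their vectors. -/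
structure BranchTree (n : ℕ) where
  glue : ℕ → Setoid (Fin n)
  glue_succ_le : ∀ t, glue (t + 1) ≤ glue t
  glue_zero : glue 0 = ⊤
  vec : (t : ℕ) → Quotient (glue t) → Fin n → ℕ

namespace BranchTree

variable {n : ℕ} (T : BranchTree n)

/-- The nodes of the tree. -/
abbrev Node : Type := Σ t : ℕ, Quotient (T.glue t)

/-- The node of the `i`-th branch at level `t + 1`. -/
def node (t : ℕ) (i : Fin n) : T.Node := ⟨t, Quotient.mk (T.glue t) i⟩

/-- The vector at a node. -/
def val (x : T.Node) : Fin n → ℕ := T.vec x.1 x.2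

/-- `F` is (the set of nodes of) a finite subtree rooted in the node of the `i`-th branch at level
`t + 1`: it contains that node, all its nodes lie above that node, and with a node at a level higher
than the root it contains the parent of the node. -/
structure IsSubtree (F : Finset T.Node) (t : ℕ) (i : Fin n) : Prop where
  root_mem : T.node t i ∈ F
  above : ∀ s h, T.node s h ∈ F → t ≤ s ∧ (T.glue t).r i h
  parent_mem : ∀ s h, t ≤ s → T.node (s + 1) h ∈ F → T.node s h ∈ F

open Classical in
/-- `T` is the multiplicity tree of a local Arf semigroup. -/
structure IsMultiplicityTree : Prop where
  eventually_unit : ∃ L, ∀ t, L ≤ t → ∀ i, T.val (T.node t i) = Pi.single i 1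
  zero_iff : ∀ t i h, T.val (T.node t i) h = 0 ↔ ¬ (T.glue t).r i h
  sum_subtree : ∀ t i, ∃ F : Finset T.Node, T.IsSubtree F t i ∧
    T.val (T.node t i) = ∑ x ∈ F.erase (T.node t i), T.val x

/-- The set of vectors determined by the tree: zero and all the sums of the nodes of a finite
subtree rooted in the root of the tree. -/
def semigroup : Set (Fin n → ℕ) :=
  {0} ∪ {x | ∃ (F : Finset T.Node) (i : Fin n), T.IsSubtree F 0 i ∧ x = ∑ y ∈ F, T.val y}

/-- The sequence of the `i`-th coordinates along the `i`-th branch. -/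
def branch (i : Fin n) (t : ℕ) : ℕ := T.val (T.node t i) i

/-- The highest level at which the `i`-th and the `j`-th branches are glued. -/
noncomputable def gluingLevel (i j : Fin n) : ℕ∞ :=
  ⨆ (t : ℕ) (_ : (T.glue t).r i j), ((t + 1 : ℕ) : ℕ∞)

end BranchTree

/-! An Arf numerical semigroup is the set of partial sums of its multiplicity sequence, so an
element is the same thing as a level. In `ℕⁿ`, fix one sequence per coordinate and let a vector of
levels `q` stand for the vector of partial sums up to `q i`. A family of gluing relations selects
the `q` such that two branches glued at a level are either left at the same level or both left above
it. These vectors form an Arf semigroup as soon as the relations separate all branches eventually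
and the last levels of the sums `m_t = m_{t+1} + ... + m_s` are themselves compatible
(`IsGluing.isArf_semigroup`).

Sufficiency: take the Du Val sequences of the sets `G[i]`, and glue the branches as long as the last
levels and the positions of the vectors of `G` permit. More gluing means fewer vectors, which is why
the result is least. To show that any Arf semigroup `S` over `G` contains it
(`semigroup_le_of_isArf`), note that `S` is a lattice, so membership can be tested on pairs of
coordinates. Below the level where branches `i` and `j` separate, `S` contains the diagonal pairs of
partial sums. The last levels or vector of `G` that cause the separation give a vector of `S`
agreeing with a diagonal one in exactly one of the two coordinates, and the exchange property then
makes the two coordinates independent above it (`IsArf.exists_mem_pair`).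

Necessity: if `(∗)` fails, there are Arf semigroups over `G` whose intersection has no conductor
(`condition_of_lower_bound`); the local case reduces to this one by discarding the nonzero vectors
with a zero coordinate.

The tree is a translation: a finite subtree through the root is determined by the level at which it
leaves each branch, and compatibility says that these levels are consistent at shared nodes. -/

/-! ### Multiplicity sequences -/

/-- The sum of the first `q` terms of a sequence. -/
def partialSum (m : ℕ → ℕ) (q : ℕ) : ℕ := ∑ k ∈ Finset.range q, m k

/-- The multiplicity sequences of the Arf numerical semigroups. -/
structure IsMultSeq (m : ℕ → ℕ) : Prop where
  pos : ∀ t, 0 < m t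
  eventually_one : ∃ L, ∀ t, L ≤ t → m t = 1
  sum_tail : ∀ t, ∃ s, t + 2 ≤ s ∧ m t = ∑ u ∈ Finset.Ico (t + 1) s, m u

@[simp]
theorem partialSum_zero (m : ℕ → ℕ) : partialSum m 0 = 0 := by simp [partialSum]

theorem partialSum_succ (m : ℕ → ℕ) (q : ℕ) : partialSum m (q + 1) = partialSum m q + m q := by
  simp [partialSum, Finset.sum_range_succ]

theorem partialSum_add_sum_Ico (m : ℕ → ℕ) {s t : ℕ} (h : t ≤ s) :
    partialSum m t + ∑ u ∈ Finset.Ico t s, m u = partialSum m s :=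
  Finset.sum_range_add_sum_Ico m h

namespace IsMultSeq

variable {m : ℕ → ℕ} (hm : IsMultSeq m)

include hm

theorem strictMono : StrictMono (partialSum m) :=
  strictMono_nat_of_lt_succ fun t => by
    have := hm.pos t
    rw [partialSum_succ]; omega

theorem lastLevel_spec (t : ℕ) :
    t + 2 ≤ lastLevel m t ∧ m t = ∑ u ∈ Finset.Ico (t + 1) (lastLevel m t), m u :=
  Nat.sInf_mem (s := {s | t + 2 ≤ s ∧ m t = ∑ u ∈ Finset.Ico (t + 1) s, m u}) (hm.sum_tail t)

theorem partialSum_lastLevel (t : ℕ) :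
    partialSum m (lastLevel m t) = partialSum m (t + 1) + m t := by
  have h := hm.lastLevel_spec t
  rw [← partialSum_add_sum_Ico m (t := t + 1) (by omega), ← h.2]

omit hm in
theorem partialSum_of_le {L : ℕ} (hL : ∀ t, L ≤ t → m t = 1) (k : ℕ) :
    partialSum m (L + k) = partialSum m L + k := by
  induction k with
  | zero => rfl
  | succ k ih => rw [← add_assoc, partialSum_succ, ih, hL _ (by omega)]; omega

/-- The Arf property in terms of levels. Writing `s_t` for the partial sums, `s_a + s_b - s_{t+1} =
s_c` by induction, and `s_{t+1} + m_t` is the partial sum at the last level of `t`; hence `s_a + s_b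
- s_t = s_c + m_t` is again of the form treated at `t + 1`. The induction descends from the range
where all terms are `1`. -/
theorem exists_partialSum_add {t a b : ℕ} (ha : t ≤ a) (hb : t ≤ b) :
    ∃ r, partialSum m r + partialSum m t = partialSum m a + partialSum m b := by
  obtain ⟨L, hL⟩ := hm.eventually_one
  obtain ⟨k, hk⟩ : ∃ k, L ≤ t + k := ⟨L, by omega⟩
  induction k generalizing t a b with
  | zero =>
    have hL' : ∀ u, t ≤ u → m u = 1 := fun u hu => hL u (by omega)
    obtain ⟨a, rfl⟩ := Nat.exists_eq_add_of_le ha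
    obtain ⟨b, rfl⟩ := Nat.exists_eq_add_of_le hb
    refine ⟨t + (a + b), ?_⟩
    simp only [partialSum_of_le hL']
    omega
  | succ k ih =>
    rcases ha.eq_or_lt with rfl | ha
    · exact ⟨b, by omega⟩
    rcases hb.eq_or_lt with rfl | hb
    · exact ⟨a, by omega⟩
    obtain ⟨c, hc⟩ := ih (t := t + 1) ha hb (by omega)
    have h1 := hm.partialSum_lastLevel t
    have h2 := (hm.lastLevel_spec t).1
    have hc' : t + 1 ≤ c := by
      by_contra! h
      have := hm.strictMono h
      have := hm.strictMono.monotone (Nat.succ_le_of_lt ha)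
      have := hm.strictMono.monotone (Nat.succ_le_of_lt hb)
      simp only [Nat.succ_eq_add_one] at *
      omega
    obtain ⟨r, hr⟩ := ih (t := t + 1) (a := c) (b := lastLevel m t) hc' (by omega) (by omega)
    refine ⟨r, ?_⟩
    have := partialSum_succ m t
    omega

/-- The numerical semigroup with a given multiplicity sequence. -/
def toSubmonoid : AddSubmonoid ℕ where
  carrier := Set.range (partialSum m)
  zero_mem' := ⟨0, partialSum_zero m⟩
  add_mem' := by
    rintro _ _ ⟨a, rfl⟩ ⟨b, rfl⟩
    obtain ⟨r, hr⟩ := hm.exists_partialSum_add (Nat.zero_le a) (Nat.zero_le b)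
    exact ⟨r, by simpa using hr⟩

theorem exists_le_partialSum : ∃ L, ∀ x, partialSum m L ≤ x → ∃ q, L ≤ q ∧ partialSum m q = x := by
  obtain ⟨L, hL⟩ := hm.eventually_one
  refine ⟨L, fun x hx => ⟨L + (x - partialSum m L), by omega, ?_⟩⟩
  rw [partialSum_of_le hL]
  omega

theorem isArfNumerical : IsArfNumerical hm.toSubmonoid where
  cofinite := by
    obtain ⟨L, hL⟩ := hm.exists_le_partialSum
    refine (Set.finite_Iio (partialSum m L)).subset fun x hx => ?_
    by_contra h
    obtain ⟨q, -, hq⟩ := hL x (by simpa using h)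
    exact hx ⟨q, hq⟩
  arf := by
    rintro _ ⟨t, rfl⟩ x y ⟨a, ha⟩ ⟨b, hb⟩
    obtain ⟨r, hr⟩ := hm.exists_partialSum_add (t := t) (a := a) (b := b)
      (hm.strictMono.le_iff_le.1 (by omega)) (hm.strictMono.le_iff_le.1 (by omega))
    exact ⟨r, by omega⟩

theorem multSeq_toSubmonoid : multSeq hm.toSubmonoid = m := by
  have hinf : (Set.range (partialSum m)).Infinite :=
    Set.infinite_range_of_injective hm.strictMono.injective
  have h : Nat.nth (fun x => x ∈ hm.toSubmonoid) = partialSum m := by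
    refine (StrictMono.range_inj (Nat.nth_strictMono hinf) hm.strictMono).1 ?_
    rw [Nat.range_nth_of_infinite hinf]
    rfl
  funext t
  rw [multSeq, h, partialSum_succ]
  omega

-- Both sequences end in ones, and the last levels determine each term from the later ones.
omit hm in
theorem eq_of_lastLevel_eq {m m' : ℕ → ℕ} (hm : IsMultSeq m) (hm' : IsMultSeq m')
    (h : ∀ t, lastLevel m t = lastLevel m' t) : m = m' := by
  obtain ⟨L, hL⟩ := hm.eventually_one
  obtain ⟨L', hL'⟩ := hm'.eventually_one
  have key : ∀ k t, max L L' ≤ t + k → m t = m' t := by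
    intro k
    induction k with
    | zero => intro t ht; rw [hL t (by omega), hL' t (by omega)]
    | succ k ih =>
      intro t ht
      rw [(hm.lastLevel_spec t).2, (hm'.lastLevel_spec t).2, h t]
      refine Finset.sum_congr rfl fun u hu => ih u ?_
      have := (Finset.mem_Ico.1 hu).1
      omega
  funext t
  exact key (max L L') t (by omega)

end IsMultSeq

theorem posE_partialSum {n : ℕ} {E : Fin n → ℕ → ℕ} {i : Fin n} (h : IsMultSeq (E i)) (q : ℕ) :
    posE E i (partialSum (E i) q) = q := by
  have : {p | partialSum (E i) q = ∑ k ∈ Finset.range p, E i k} = {q} := by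
    ext p
    change partialSum (E i) q = partialSum (E i) p ↔ p = q
    rw [h.strictMono.injective.eq_iff, eq_comm]
  rw [posE, this, csInf_singleton]

/-- If the sums `m_t = m_{t+1} + ... + m_s` of two multiplicity sequences have the same lengths up to
level `p`, then sums and differences of partial sums agree up to level `p`. -/
theorem IsMultSeq.eq_or_le_of_partialSum_add {m m' : ℕ → ℕ} (hm : IsMultSeq m) (hm' : IsMultSeq m')
    {p : ℕ} (h : ∀ t, lastLevel m t = lastLevel m' t ∨ p ≤ min (lastLevel m t) (lastLevel m' t))
    {t a b r r' : ℕ} (ha : t ≤ a) (hb : t ≤ b)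
    (hr : partialSum m r + partialSum m t = partialSum m a + partialSum m b)
    (hr' : partialSum m' r' + partialSum m' t = partialSum m' a + partialSum m' b) :
    r = r' ∨ p ≤ min r r' := by
  have low : ∀ {m : ℕ → ℕ}, IsMultSeq m → ∀ {t a b r : ℕ}, t ≤ a → t ≤ b →
      partialSum m r + partialSum m t = partialSum m a + partialSum m b → a ≤ r ∧ b ≤ r := by
    intro m hm t a b r ha hb hr
    have h1 := hm.strictMono.monotone ha
    have h2 := hm.strictMono.monotone hb
    exact ⟨hm.strictMono.le_iff_le.1 (by omega), hm.strictMono.le_iff_le.1 (by omega)⟩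
  -- Induction on `p - t`; once `p ≤ t`, `low` already places both `r` and `r'` at `p` or beyond.
  obtain ⟨k, hk⟩ : ∃ k, p ≤ t + k := ⟨p, by omega⟩
  induction k generalizing t a b r r' with
  | zero =>
    have := low hm ha hb hr
    have := low hm' ha hb hr'
    omega
  | succ k ih =>
    rcases ha.eq_or_lt with rfl | ha
    · left
      rw [hm.strictMono.injective (show partialSum m r = partialSum m b by omega),
        hm'.strictMono.injective (show partialSum m' r' = partialSum m' b by omega)]
    rcases hb.eq_or_lt with rfl | hb
    · left
      rw [hm.strictMono.injective (show partialSum m r = partialSum m a by omega),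
        hm'.strictMono.injective (show partialSum m' r' = partialSum m' a by omega)]
    obtain ⟨c, hc⟩ := hm.exists_partialSum_add (t := t + 1) ha hb
    obtain ⟨c', hc'⟩ := hm'.exists_partialSum_add (t := t + 1) ha hb
    have h1 := hm.partialSum_lastLevel t
    have h1' := hm'.partialSum_lastLevel t
    have h2 := (hm.lastLevel_spec t).1
    have h2' := (hm'.lastLevel_spec t).1
    have h3 := partialSum_succ m t
    have h3' := partialSum_succ m' t
    have l := low hm ha hb hc
    have l' := low hm' ha hb hc'
    have e : partialSum m r + partialSum m (t + 1) =
      partialSum m c + partialSum m (lastLevel m t) := by omega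
    have e' : partialSum m' r' + partialSum m' (t + 1) =
      partialSum m' c' + partialSum m' (lastLevel m' t) := by omega
    have k1 := low hm (by omega) (by omega) e
    have k1' := low hm' (by omega) (by omega) e'
    -- The recursion of `exists_partialSum_add` runs for both sequences at once. It can diverge only
    -- through `c ≠ c'` or through different last levels, which are then all at least `p` and bound
    -- `r` and `r'` from below.
    rcases ih (t := t + 1) ha hb hc hc' (by omega) with rfl | hp
    · rcases h t with hs | hp
      · rw [← hs] at e'
        exact ih (t := t + 1) (by omega) (by omega) e e' (by omega)
      · omega
    · omega

/-! ### Du Val's algorithm -/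

theorem minPos_mem {I : Set ℕ} (h : ∃ x ∈ I, x ≠ 0) : minPos I ∈ I ∧ 0 < minPos I := by
  obtain ⟨x, hx, hx0⟩ := h
  have := Nat.sInf_mem (s := I \ {0}) ⟨x, hx, hx0⟩
  exact ⟨this.1, Nat.pos_of_ne_zero this.2⟩

theorem minPos_le {I : Set ℕ} {x : ℕ} (hx : x ∈ I) (h0 : x ≠ 0) : minPos I ≤ x :=
  Nat.sInf_le ⟨hx, h0⟩

theorem setGcd_duValStep {I : Set ℕ} (h : Nat.setGcd I = 1) : Nat.setGcd (duValStep I) = 1 := by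
  refine Nat.dvd_one.1 (h ▸ Nat.dvd_setGcd_iff.2 fun x hx => ?_)
  rcases eq_or_ne x 0 with rfl | h0
  · exact dvd_zero _
  · have h1 : Nat.setGcd (duValStep I) ∣ minPos I := Nat.setGcd_dvd_of_mem (Set.mem_insert _ _)
    have h2 : Nat.setGcd (duValStep I) ∣ x - minPos I :=
      Nat.setGcd_dvd_of_mem (Set.mem_insert_of_mem _ ⟨x, ⟨hx, h0⟩, rfl⟩)
    have := dvd_add h2 h1
    rwa [Nat.sub_add_cancel (minPos_le hx h0)] at this

section DuVal

variable {I : Set ℕ} (hI : Nat.setGcd I = 1)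

theorem sub_duVal_mem {t x : ℕ} (hx : x ∈ duValStep^[t] I) (h0 : x ≠ 0) :
    duVal I t ≤ x ∧ x - duVal I t ∈ duValStep^[t + 1] I := by
  refine ⟨minPos_le hx h0, ?_⟩
  rw [Function.iterate_succ_apply']
  exact Set.mem_insert_of_mem _ ⟨x, ⟨hx, h0⟩, rfl⟩

theorem duVal_mem_succ (I : Set ℕ) (t : ℕ) : duVal I t ∈ duValStep^[t + 1] I := by
  rw [Function.iterate_succ_apply']
  exact Set.mem_insert _ _

include hI

theorem setGcd_duValStep_iterate (t : ℕ) : Nat.setGcd (duValStep^[t] I) = 1 := by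
  induction t with
  | zero => exact hI
  | succ t ih => rw [Function.iterate_succ_apply']; exact setGcd_duValStep ih

theorem duVal_mem (t : ℕ) : duVal I t ∈ duValStep^[t] I ∧ 0 < duVal I t :=
  minPos_mem (Nat.exists_ne_zero_of_setGcd_ne_zero
    (by rw [setGcd_duValStep_iterate hI t]; exact one_ne_zero))

/-- A nonzero `x` in the `t`-th set leaves the smaller `x - m_t` in the next one. At `t = 0` this
writes the elements of `I` as partial sums; applied to `m_t`, which lies in the set of index `t +
1`, it gives the sum property of multiplicity sequences. -/
theorem exists_sum_Ico_duVal (x : ℕ) :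
    ∀ t, x ∈ duValStep^[t] I → ∃ s, t ≤ s ∧ x = ∑ u ∈ Finset.Ico t s, duVal I u := by
  induction x using Nat.strong_induction_on with
  | _ x ih =>
    intro t hx
    rcases eq_or_ne x 0 with rfl | h0
    · exact ⟨t, le_rfl, by simp⟩
    · obtain ⟨h1, h2⟩ := sub_duVal_mem hx h0
      have h3 := (duVal_mem hI t).2
      obtain ⟨s, hs, e⟩ := ih (x - duVal I t) (by omega) (t + 1) h2
      refine ⟨s, by omega, ?_⟩
      rw [Finset.sum_eq_sum_Ico_succ_bot (by omega)]
      omega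

/-- The sequence is antitone, hence eventually a constant `d`. From then on the elements are reduced
to `0` by subtracting `d` only, so `d` divides them all, while the algorithm preserves the gcd `1`.
-/
theorem duVal_eventually_one : ∃ L, ∀ t, L ≤ t → duVal I t = 1 := by
  have anti : Antitone (duVal I) := antitone_nat_of_succ_le fun t =>
    minPos_le (duVal_mem_succ I t) (duVal_mem hI t).2.ne'
  obtain ⟨L, hL⟩ := Nat.sInf_mem (Set.range_nonempty (duVal I))
  have hc : ∀ t, L ≤ t → duVal I t = duVal I L := fun t ht =>
    le_antisymm (anti ht) (hL.trans_le (Nat.sInf_le ⟨t, rfl⟩))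
  have key : ∀ x t, L ≤ t → x ∈ duValStep^[t] I → duVal I L ∣ x := by
    intro x
    induction x using Nat.strong_induction_on with
    | _ x ih =>
      intro t ht hx
      rcases eq_or_ne x 0 with rfl | h0
      · exact dvd_zero _
      · obtain ⟨h1, h2⟩ := sub_duVal_mem hx h0
        have h3 := (duVal_mem hI t).2
        have h4 := ih _ (by omega) (t + 1) (by omega) h2
        rw [hc t ht] at h1 h4
        exact (Nat.dvd_sub_iff_left h1 dvd_rfl).1 h4
  refine ⟨L, fun t ht => (hc t ht).trans (Nat.dvd_one.1 ?_)⟩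
  rw [← setGcd_duValStep_iterate hI L]
  exact Nat.dvd_setGcd_iff.2 fun x hx => key x L le_rfl hx

theorem isMultSeq_duVal : IsMultSeq (duVal I) where
  pos t := (duVal_mem hI t).2
  eventually_one := duVal_eventually_one hI
  sum_tail t := by
    obtain ⟨s, hs, e⟩ := exists_sum_Ico_duVal hI _ _ (duVal_mem_succ I t)
    refine ⟨s, ?_, e⟩
    by_contra! h
    have : s = t + 1 := by omega
    subst this
    have := (duVal_mem hI t).2
    simp at e
    omega

theorem exists_partialSum_duVal {x : ℕ} (hx : x ∈ I) : ∃ q, x = partialSum (duVal I) q := by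
  obtain ⟨s, -, e⟩ := exists_sum_Ico_duVal hI x 0 hx
  exact ⟨s, by rw [e, partialSum, Finset.range_eq_Ico]⟩

/-- The invariant is that `B` contains the whole `t`-th set translated by the `t`-th partial sum.
Only the Arf property of `B` is required, so that projections of Arf semigroups qualify. -/
theorem partialSum_duVal_mem {B : AddSubmonoid ℕ}
    (hB : ∀ α ∈ B, ∀ x y, α + x ∈ B → α + y ∈ B → α + (x + y) ∈ B) (h : I ⊆ (B : Set ℕ)) (t : ℕ) :
    partialSum (duVal I) t ∈ B := by
  suffices key : partialSum (duVal I) t ∈ B ∧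
      ∀ x ∈ duValStep^[t] I, partialSum (duVal I) t + x ∈ B from key.1
  induction t with
  | zero => exact ⟨by simp, fun x hx => by simpa using h hx⟩
  | succ t ih =>
    have h1 := ih.2 _ (duVal_mem hI t).1
    refine ⟨by rwa [partialSum_succ], fun x hx => ?_⟩
    rw [Function.iterate_succ_apply'] at hx
    rw [partialSum_succ]
    rcases hx with rfl | ⟨y, ⟨hy, h0⟩, rfl⟩
    · rw [add_assoc]
      exact hB _ ih.1 _ _ h1 h1
    · have h2 := ih.2 y hy
      have h3 : minPos (duValStep^[t] I) ≤ y := minPos_le hy h0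
      have : partialSum (duVal I) t + duVal I t + (y - minPos (duValStep^[t] I)) =
        partialSum (duVal I) t + y := by
        change _ + minPos (duValStep^[t] I) + _ = _
        omega
      simpa only [this] using h2

theorem isLeast_toSubmonoid_duVal :
    IsLeast {B : AddSubmonoid ℕ | IsArfNumerical B ∧ I ⊆ (B : Set ℕ)}
      (isMultSeq_duVal hI).toSubmonoid := by
  refine ⟨⟨(isMultSeq_duVal hI).isArfNumerical, fun x hx => ?_⟩, ?_⟩
  · obtain ⟨q, hq⟩ := exists_partialSum_duVal hI hx
    exact ⟨q, hq.symm⟩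
  · rintro B ⟨hB, hIB⟩ _ ⟨q, rfl⟩
    exact partialSum_duVal_mem hI hB.arf hIB q

end DuVal

/-! ### Semigroups determined by multiplicity sequences and gluing relations -/

/-- The level vectors compatible with gluing relations: where two branches leave the subtree at
different levels, they are no longer glued. -/
def levelVectors {n : ℕ} (R : ℕ → Setoid (Fin n)) : Set (Fin n → ℕ) :=
  {q | ∀ t i j, (R t).r i j → q i = q j ∨ t < min (q i) (q j)}

/-- The multiplicity sequences `m i` can be glued along the relations `R t`. -/
structure IsGluing {n : ℕ} (m : Fin n → ℕ → ℕ) (R : ℕ → Setoid (Fin n)) : Prop where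
  isMultSeq : ∀ i, IsMultSeq (m i)
  separated : ∃ L, ∀ t, L ≤ t → ∀ i j, (R t).r i j → i = j
  lastLevel_mem : ∀ t, (fun i => lastLevel (m i) t) ∈ levelVectors R

/-- The vectors of the partial sums of the sequences `m i`. -/
def partialSums {n : ℕ} (m : Fin n → ℕ → ℕ) (q : Fin n → ℕ) : Fin n → ℕ :=
  fun i => partialSum (m i) (q i)

namespace IsGluing

variable {n : ℕ} {m : Fin n → ℕ → ℕ} {R : ℕ → Setoid (Fin n)} (h : IsGluing m R)

include h

/-- The levels `r` are found coordinatewise. If `q`, `a`, `b` each agree on two glued branches,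
compatibility of the last levels passes to `r`; otherwise one of them is above level `t` on both
branches, and `r` lies above it. -/
theorem exists_partialSums_add {q a b : Fin n → ℕ} (hq : q ∈ levelVectors R)
    (ha : a ∈ levelVectors R) (hb : b ∈ levelVectors R) (hqa : q ≤ a) (hqb : q ≤ b) :
    ∃ r ∈ levelVectors R, partialSums m r + partialSums m q = partialSums m a + partialSums m b := by
  choose r hr using fun i => (h.isMultSeq i).exists_partialSum_add (hqa i) (hqb i)
  refine ⟨r, fun t i j hij => ?_, funext hr⟩
  have low : ∀ i, a i ≤ r i ∧ b i ≤ r i := fun i => by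
    have hm := (h.isMultSeq i).strictMono
    have h1 := hm.monotone (hqa i)
    have h2 := hm.monotone (hqb i)
    have h3 := hr i
    exact ⟨hm.le_iff_le.1 (by omega), hm.le_iff_le.1 (by omega)⟩
  have := low i
  have := low j
  have : q i ≤ a i := hqa i
  have : q j ≤ a j := hqa j
  rcases hq t i j hij with eq | hlt
  · rcases ha t i j hij with ea | hlt
    · rcases hb t i j hij with eb | hlt
      · refine (h.isMultSeq i).eq_or_le_of_partialSum_add (h.isMultSeq j) (p := t + 1)
          (fun u => h.lastLevel_mem u t i j hij) (hqa i) (hqb i) (hr i) ?_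
        rw [eq, ea, eb]
        exact hr j
      · omega
    · omega
  · omega

/-- The semigroup of the vectors of partial sums up to compatible levels. -/
def semigroup : AddSubmonoid (Fin n → ℕ) where
  carrier := partialSums m '' levelVectors R
  zero_mem' := ⟨0, fun t i j _ => Or.inl rfl, funext fun i => by simp [partialSums]⟩
  add_mem' := by
    rintro _ _ ⟨a, ha, rfl⟩ ⟨b, hb, rfl⟩
    obtain ⟨r, hr, e⟩ := h.exists_partialSums_add (q := 0) (fun t i j _ => Or.inl rfl) ha hb
      (fun i => Nat.zero_le _) (fun i => Nat.zero_le _)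
    refine ⟨r, hr, e ▸ funext fun i => by simp [partialSums]⟩

theorem le_of_partialSums_le {q a : Fin n → ℕ} (hqa : partialSums m q ≤ partialSums m a) : q ≤ a :=
  fun i => (h.isMultSeq i).strictMono.le_iff_le.1 (hqa i)

theorem partialSums_inf (a b : Fin n → ℕ) :
    partialSums m (a ⊓ b) = partialSums m a ⊓ partialSums m b :=
  funext fun i => (h.isMultSeq i).strictMono.monotone.map_min

theorem isArf_semigroup : IsArf h.semigroup where
  inf_mem := by
    rintro _ ⟨a, ha, rfl⟩ _ ⟨b, hb, rfl⟩
    refine ⟨a ⊓ b, fun t i j hij => ?_, h.partialSums_inf a b⟩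
    have h1 := ha t i j hij
    have h2 := hb t i j hij
    simp only [Pi.inf_apply]
    omega
  exchange := by
    rintro _ ⟨a, ha, rfl⟩ _ ⟨b, hb, rfl⟩ i hi
    have hi : a i = b i := (h.isMultSeq i).strictMono.injective hi
    -- The exchange vector is the minimum, moved up one level on every branch where `a` and `b`
    -- agree.
    refine ⟨_, ⟨fun k => min (a k) (b k) + if a k = b k then 1 else 0, fun t k l hkl => ?_, rfl⟩,
      ?_, fun j _ => ⟨?_, fun hj => ?_⟩⟩
    · have h1 := ha t k l hkl
      have h2 := hb t k l hkl
      dsimp only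
      split_ifs <;> omega
    · refine (h.isMultSeq i).strictMono ?_
      dsimp only
      rw [if_pos hi]
      omega
    · refine (h.isMultSeq j).strictMono.monotone.map_min.symm.trans_le
        ((h.isMultSeq j).strictMono.monotone ?_)
      exact Nat.le_add_right _ _
    · have hj : a j ≠ b j := fun e => hj (by rw [partialSums, partialSums, e])
      simp only [partialSums, if_neg hj, add_zero]
      exact (h.isMultSeq j).strictMono.monotone.map_min
  conductor := by
    obtain ⟨L, hL⟩ := h.separated
    choose M hM using fun i => (h.isMultSeq i).exists_le_partialSum
    -- Level `L` lies beyond all gluing, and from level `M i` on every integer is a partial sum.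
    have key : ∀ x, partialSums m (fun i => L + M i) ≤ x → x ∈ h.semigroup := by
      intro x hx
      choose q hq e using fun i => hM i (x i)
        (((h.isMultSeq i).strictMono.monotone (Nat.le_add_left _ _)).trans (hx i))
      refine ⟨q, fun t i j hij => ?_, funext e⟩
      have low : ∀ i, L ≤ q i := fun i => by
        have : L + M i ≤ q i :=
          (h.isMultSeq i).strictMono.le_iff_le.1 ((hx i).trans_eq (e i).symm)
        omega
      by_cases ht : L ≤ t
      · exact Or.inl (congrArg q (hL t ht i j hij))
      · have := low i
        have := low j
        omega
    exact ⟨_, key _ le_rfl, fun x => key _ (fun i => Nat.le_add_right _ _)⟩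
  arf := by
    rintro _ ⟨q, hq, rfl⟩ x y ⟨a, ha, ea⟩ ⟨b, hb, eb⟩
    obtain ⟨r, hr, e⟩ := h.exists_partialSums_add hq ha hb
      (h.le_of_partialSums_le (ea ▸ fun i => Nat.le_add_right _ _))
      (h.le_of_partialSums_le (eb ▸ fun i => Nat.le_add_right _ _))
    refine ⟨r, hr, add_right_cancel (b := partialSums m q) ?_⟩
    rw [e, ea, eb]
    abel

theorem isLocalSemigroup_semigroup (h0 : R 0 = ⊤) : IsLocalSemigroup h.semigroup := by
  rintro _ ⟨q, hq, rfl⟩ ⟨i, hi⟩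
  have hi : q i = 0 := (h.isMultSeq i).strictMono.injective (hi.trans (partialSum_zero _).symm)
  funext j
  have hj : q j = 0 := by
    have := hq 0 i j (by rw [h0]; trivial)
    omega
  simp [partialSums, hj]

end IsGluing

/-! ### Arf semigroups as lattices -/

section Lattice

variable {n : ℕ} {S : AddSubmonoid (Fin n → ℕ)}

/-- `a ⊔ b` is `a ⊓ b` plus the two differences `a - a ⊓ b` and `b - a ⊓ b`, since in each
coordinate one of them vanishes. -/
theorem sup_mem_of_arf (hinf : ∀ a ∈ S, ∀ b ∈ S, a ⊓ b ∈ S)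
    (harf : ∀ α ∈ S, ∀ x y, α + x ∈ S → α + y ∈ S → α + (x + y) ∈ S) {a b : Fin n → ℕ}
    (ha : a ∈ S) (hb : b ∈ S) : a ⊔ b ∈ S := by
  have h1 : a ⊓ b + (a - a ⊓ b) = a := add_tsub_cancel_of_le inf_le_left
  have h2 : a ⊓ b + (b - a ⊓ b) = b := add_tsub_cancel_of_le inf_le_right
  convert harf _ (hinf a ha b hb) (a - a ⊓ b) (b - a ⊓ b) (by rwa [h1]) (by rwa [h2]) using 1
  funext i
  simp only [Pi.sup_apply, Pi.add_apply, Pi.sub_apply, Pi.inf_apply]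
  omega

/-- If `a i = b i` and `a j < b j` for vectors `a`, `b` of `S`, there are vectors of `S` with the same
`i`-th coordinate and arbitrarily large `j`-th coordinate. -/
theorem exists_mem_large_of_arf (hinf : ∀ a ∈ S, ∀ b ∈ S, a ⊓ b ∈ S)
    (harf : ∀ α ∈ S, ∀ x y, α + x ∈ S → α + y ∈ S → α + (x + y) ∈ S) {a b : Fin n → ℕ}
    (ha : a ∈ S) (hb : b ∈ S) {i j : Fin n} (hi : a i = b i) (hj : a j < b j) (N : ℕ) :
    ∃ c ∈ S, c i = a i ∧ N ≤ c j := by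
  have h1 : a ⊓ b + (b - a ⊓ b) = b := add_tsub_cancel_of_le inf_le_right
  -- The increment `b - a ⊓ b` is zero in coordinate `i` and positive in coordinate `j`.
  have key : ∀ k : ℕ, a ⊓ b + k • (b - a ⊓ b) ∈ S := by
    intro k
    induction k with
    | zero => simpa using hinf a ha b hb
    | succ k ih =>
      rw [succ_nsmul]
      exact harf _ (hinf a ha b hb) _ _ ih (by rwa [h1])
  refine ⟨_, key N, ?_, ?_⟩
  · simp [hi]
  · simp only [Pi.add_apply, Pi.smul_apply, Pi.sub_apply, Pi.inf_apply, smul_eq_mul]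
    have : 1 ≤ b j - min (a j) (b j) := by omega
    exact (Nat.le_mul_of_pos_right N this).trans (Nat.le_add_left _ _)

/-- If `y i j` agrees with `x` in coordinates `i` and `j`, then `⨆ j, y i j` dominates `x` with
equality at `i`, so the infimum of these over `i` is `x`. -/
theorem mem_of_forall_pair (hinf : ∀ a ∈ S, ∀ b ∈ S, a ⊓ b ∈ S)
    (hsup : ∀ a ∈ S, ∀ b ∈ S, a ⊔ b ∈ S) {x : Fin n → ℕ}
    (hx : ∀ i j, ∃ y ∈ S, y i = x i ∧ y j = x j) : x ∈ S := by
  rcases isEmpty_or_nonempty (Fin n) with hn | hn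
  · exact (Subsingleton.elim 0 x) ▸ S.zero_mem
  choose y hyS hyi hyj using hx
  have hne : (Finset.univ : Finset (Fin n)).Nonempty := Finset.univ_nonempty
  have hz : ∀ i, Finset.univ.sup' hne (y i) ∈ S := fun i =>
    Finset.sup'_mem (S : Set (Fin n → ℕ)) hsup _ _ _ fun j _ => hyS i j
  have hw : Finset.univ.inf' hne (fun i => Finset.univ.sup' hne (y i)) ∈ S :=
    Finset.inf'_mem (S : Set (Fin n → ℕ)) hinf _ _ _ fun i _ => hz i
  convert hw using 1
  funext k
  rw [Finset.inf'_apply]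
  refine le_antisymm (Finset.le_inf' _ _ fun i _ => ?_) ((Finset.inf'_le _ (Finset.mem_univ k)).trans ?_)
  · rw [Finset.sup'_apply]
    exact (hyj i k).symm.le.trans (Finset.le_sup' (fun j => y i j k) (Finset.mem_univ k))
  · rw [Finset.sup'_apply]
    exact Finset.sup'_le _ _ fun j _ => (hyi k j).le

/-- The lifts `b`, `c` need not dominate the lift `a`, so the Arf property is applied at `a ⊓ b ⊓
c`, which has the same `i`-th coordinate as `a`. -/
theorem map_eval_arf (hinf : ∀ a ∈ S, ∀ b ∈ S, a ⊓ b ∈ S)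
    (harf : ∀ α ∈ S, ∀ x y, α + x ∈ S → α + y ∈ S → α + (x + y) ∈ S) (i : Fin n) :
    ∀ α ∈ S.map (Pi.evalAddMonoidHom _ i), ∀ x y, α + x ∈ S.map (Pi.evalAddMonoidHom _ i) →
      α + y ∈ S.map (Pi.evalAddMonoidHom _ i) →
      α + (x + y) ∈ S.map (Pi.evalAddMonoidHom (fun _ => ℕ) i) := by
  rintro _ ⟨a, ha, rfl⟩ x y ⟨b, hb, eb⟩ ⟨c, hc, ec⟩
  have h1 : a ⊓ b ⊓ c + (b - a ⊓ b ⊓ c) = b :=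
    add_tsub_cancel_of_le (inf_le_left.trans inf_le_right)
  have h2 : a ⊓ b ⊓ c + (c - a ⊓ b ⊓ c) = c := add_tsub_cancel_of_le inf_le_right
  refine ⟨_, harf _ (hinf _ (hinf a ha b hb) c hc) (b - a ⊓ b ⊓ c) (c - a ⊓ b ⊓ c)
    (by rwa [h1]) (by rwa [h2]), ?_⟩
  simp only [Pi.evalAddMonoidHom_apply] at eb ec ⊢
  simp only [Pi.add_apply, Pi.sub_apply, Pi.inf_apply]
  omega

end Lattice

/-! ### The Arf closure -/

/-- If two vectors of an Arf semigroup agree in the coordinate `i` but not in the coordinate `j`, then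
the coordinates `i` and `j` can be chosen independently above the smaller vector. -/
theorem IsArf.exists_mem_pair {n : ℕ} {S : AddSubmonoid (Fin n → ℕ)} (hS : IsArf S)
    {w v y z : Fin n → ℕ} (hw : w ∈ S) (hv : v ∈ S) (hy : y ∈ S) (hz : z ∈ S) {i j : Fin n}
    (hij : i ≠ j) (hi : w i = v i) (hj : w j < v j) (hyi : w i ≤ y i) (hzj : w j ≤ z j) :
    ∃ u ∈ S, u i = y i ∧ u j = z j := by
  have hsup := fun {a b} => sup_mem_of_arf hS.inf_mem hS.arf (a := a) (b := b)
  obtain ⟨a, ha, hai, haj⟩ := exists_mem_large_of_arf hS.inf_mem hS.arf hw hv hi hj (z j)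
  obtain ⟨c, hc, hci, hcj⟩ := hS.exchange w hw v hv i hi
  have hcj := (hcj j hij.symm).2 hj.ne
  obtain ⟨b, hb, hbj, hbi⟩ :=
    exists_mem_large_of_arf hS.inf_mem hS.arf hw hc (i := j) (j := i) (by omega) hci (y i)
  -- In coordinates `(i, j)`, `b` is (large, `w j`) and `a` is (`w i`, large), so the two terms are
  -- `(y i, w j)` and `(w i, z j)`.
  refine ⟨((y ⊔ w) ⊓ b) ⊔ ((z ⊔ w) ⊓ a), hsup (hS.inf_mem _ (hsup hy hw) _ hb)
    (hS.inf_mem _ (hsup hz hw) _ ha), ?_, ?_⟩ <;>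
  · simp only [Pi.sup_apply, Pi.inf_apply]
    omega

variable {n : ℕ}

/-- The level vectors which bound the levels at which the branches can be glued. -/
def boundingVectors (E : Fin n → ℕ → ℕ) (G : Set (Fin n → ℕ)) : Set (Fin n → ℕ) :=
  {x | (∃ t, x = fun i => lastLevel (E i) t) ∨ ∃ g ∈ G, x = fun i => posE E i (g i)}

/-- The finest gluing relations for which the bounding vectors are compatible level vectors. -/
def gluingRel (E : Fin n → ℕ → ℕ) (G : Set (Fin n → ℕ)) (t : ℕ) : Setoid (Fin n) where
  r i j := ∀ x ∈ boundingVectors E G, x i = x j ∨ t < min (x i) (x j)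
  iseqv :=
    { refl := fun _ _ _ => Or.inl rfl
      symm := fun h x hx => by
        have := h x hx
        omega
      trans := fun h h' x hx => by
        have := h x hx
        have := h' x hx
        omega }

theorem gluingRel_anti (E : Fin n → ℕ → ℕ) (G : Set (Fin n → ℕ)) {s t : ℕ} (hst : s ≤ t) :
    gluingRel E G t ≤ gluingRel E G s := fun {i j} h x hx => by
  have : x i = x j ∨ t < min (x i) (x j) := h x hx
  omega

theorem boundingVectors_subset (E : Fin n → ℕ → ℕ) (G : Set (Fin n → ℕ)) :
    boundingVectors E G ⊆ levelVectors (gluingRel E G) :=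
  fun x hx _ _ _ h => h x hx

section Closure

variable {G : Set (Fin n → ℕ)} {E : Fin n → ℕ → ℕ}

theorem partialSum_posE_of_mem (hE : ∀ i, E i = duVal (coords G i))
    (hgcd : ∀ i, Nat.setGcd (coords G i) = 1) {g : Fin n → ℕ} (hg : g ∈ G) (i : Fin n) :
    partialSum (E i) (posE E i (g i)) = g i := by
  obtain ⟨q, hq⟩ := exists_partialSum_duVal (hgcd i) ⟨g, hg, rfl⟩
  have hm : IsMultSeq (E i) := by rw [hE]; exact isMultSeq_duVal (hgcd i)
  rw [← hE] at hq
  rw [show g i = partialSum (E i) q from hq, posE_partialSum hm]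

variable (hE : ∀ i, E i = duVal (coords G i)) (hgcd : ∀ i, Nat.setGcd (coords G i) = 1)

include hE hgcd

/-- Branches glued at all levels have equal last levels, hence equal sequences; equal positions then
give `g i = g j` for all `g` in `G`. -/
theorem exists_not_gluingRel {i j : Fin n} (hsep : ∃ g ∈ G, g i ≠ g j) :
    ∃ t, ¬ (gluingRel E G t).r i j := by
  by_contra! hall
  have hx : ∀ x ∈ boundingVectors E G, x i = x j := fun x hx => by
    have : x i = x j ∨ x i < min (x i) (x j) := hall (x i) x hx
    omega
  have hm : ∀ i, IsMultSeq (E i) := fun i => by rw [hE]; exact isMultSeq_duVal (hgcd i)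
  have e : E i = E j := IsMultSeq.eq_of_lastLevel_eq (hm i) (hm j)
    fun t => hx _ (Or.inl ⟨t, rfl⟩)
  obtain ⟨g, hg, hne⟩ := hsep
  refine hne ?_
  have := hx _ (Or.inr ⟨g, hg, rfl⟩)
  rw [← partialSum_posE_of_mem hE hgcd hg i, ← partialSum_posE_of_mem hE hgcd hg j, e]
  exact congrArg _ this

theorem isGluing_gluingRel (hsep : ∀ i j, i < j → ∃ g ∈ G, g i ≠ g j) :
    IsGluing E (gluingRel E G) where
  isMultSeq i := by rw [hE]; exact isMultSeq_duVal (hgcd i)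
  separated := by
    rw [← Filter.eventually_atTop, Filter.eventually_all]
    intro i
    rw [Filter.eventually_all]
    intro j
    rcases eq_or_ne i j with h | h
    · exact Filter.Eventually.of_forall fun _ _ => h
    have : ∃ g ∈ G, g i ≠ g j := by
      rcases h.lt_or_gt with h | h
      · exact hsep i j h
      · obtain ⟨g, hg, hne⟩ := hsep j i h
        exact ⟨g, hg, hne.symm⟩
    obtain ⟨t, ht⟩ := exists_not_gluingRel hE hgcd this
    filter_upwards [Filter.eventually_ge_atTop t] with s hs h
    exact absurd (gluingRel_anti E G hs h) ht
  lastLevel_mem t := boundingVectors_subset E G (Or.inl ⟨t, rfl⟩)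

theorem subset_semigroup (h : IsGluing E (gluingRel E G)) :
    G ⊆ (h.semigroup : Set (Fin n → ℕ)) := fun g hg =>
  ⟨_, boundingVectors_subset E G (Or.inr ⟨g, hg, rfl⟩),
    funext fun i => partialSum_posE_of_mem hE hgcd hg i⟩

theorem semigroup_le_of_isArf (h : IsGluing E (gluingRel E G)) {S : AddSubmonoid (Fin n → ℕ)}
    (hS : IsArf S) (hG : G ⊆ (S : Set (Fin n → ℕ))) : h.semigroup ≤ S := by
  have hA := h.isArf_semigroup
  have hsup := fun {a b} => sup_mem_of_arf hS.inf_mem hS.arf (a := a) (b := b)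
  -- Intersecting with the candidate makes every lifted vector come from a compatible level vector.
  set P := S ⊓ h.semigroup with hP
  have Pinf : ∀ a ∈ P, ∀ b ∈ P, a ⊓ b ∈ P := fun a ha b hb =>
    ⟨hS.inf_mem a ha.1 b hb.1, hA.inf_mem a ha.2 b hb.2⟩
  have Parf : ∀ α ∈ P, ∀ x y, α + x ∈ P → α + y ∈ P → α + (x + y) ∈ P := fun α hα x y hx hy =>
    ⟨hS.arf α hα.1 x y hx.1 hy.1, hA.arf α hα.2 x y hx.2 hy.2⟩
  have lift : ∀ i t, ∃ a ∈ levelVectors (gluingRel E G), partialSums E a ∈ S ∧ a i = t := by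
    intro i t
    obtain ⟨y, ⟨hyS, a, ha, rfl⟩, hy⟩ : partialSum (E i) t ∈ P.map (Pi.evalAddMonoidHom _ i) := by
      rw [hE]
      refine partialSum_duVal_mem (hgcd i) (map_eval_arf Pinf Parf i) ?_ t
      rintro _ ⟨g, hg, rfl⟩
      exact ⟨g, ⟨hG hg, subset_semigroup hE hgcd h hg⟩, rfl⟩
    exact ⟨a, ha, hyS, (h.isMultSeq i).strictMono.injective hy⟩
  rintro _ ⟨q, hq, rfl⟩
  refine mem_of_forall_pair hS.inf_mem (fun a ha b hb => hsup ha hb) fun i j => ?_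
  rcases eq_or_ne i j with rfl | hij
  · obtain ⟨a, -, haS, e⟩ := lift i (q i)
    have : partialSums E a i = partialSums E q i := by rw [partialSums, partialSums, e]
    exact ⟨_, haS, this, this⟩
  have hex : ∃ t, ¬ (gluingRel E G t).r i j := by
    obtain ⟨L, hL⟩ := h.separated
    exact ⟨L, fun hr => hij (hL L le_rfl i j hr)⟩
  classical
  obtain ⟨p, hp, hlt⟩ : ∃ p, ¬ (gluingRel E G p).r i j ∧ ∀ t < p, (gluingRel E G t).r i j :=
    ⟨Nat.find hex, Nat.find_spec hex, fun t ht => not_not.1 (Nat.find_min hex ht)⟩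
  -- Gluing at index `t` forces unequal levels to be at least `t + 1`, so gluing at all indices
  -- below `p` gives the bound `p`.
  have level : ∀ a ∈ levelVectors (gluingRel E G), ∀ t ≤ p, a i = a j ∨ t ≤ min (a i) (a j) := by
    intro a ha t ht
    rcases t with _ | t
    · exact Or.inr (Nat.zero_le _)
    · exact ha t i j (hlt t ht)
  -- Take the minimum of a lift with `i`-th level `t` and a lift with `j`-th level `t`: by `level`,
  -- neither is below `t` in the other coordinate.
  have diag : ∀ t ≤ p, ∃ w ∈ S, w i = partialSum (E i) t ∧ w j = partialSum (E j) t := by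
    intro t ht
    obtain ⟨a, ha, haS, rfl⟩ := lift i t
    obtain ⟨b, hb, hbS, e⟩ := lift j (a i)
    have h1 := level a ha _ ht
    have h2 := level b hb _ ht
    refine ⟨_, hS.inf_mem _ haS _ hbS, ?_, ?_⟩ <;>
    · rw [← h.partialSums_inf]
      refine congrArg (partialSum _) ?_
      simp only [Pi.inf_apply]
      omega
  -- Some bounding vector forbids gluing at index `p`, and being compatible below `p` it has minimum
  -- exactly `p`.
  obtain ⟨c, hc, hne, hmin⟩ : ∃ c ∈ boundingVectors E G, c i ≠ c j ∧ min (c i) (c j) = p := by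
    by_contra! hcon
    refine hp fun x hx => ?_
    have h1 := hcon x hx
    have h2 := level x (boundingVectors_subset E G hx) p le_rfl
    omega
  obtain ⟨v, hv, hvi, hvj⟩ : ∃ v ∈ S, v i = partialSum (E i) (c i) ∧
      v j = partialSum (E j) (c j) := by
    -- For last levels, the diagonal vectors at `t` and `t + 1` differ by the terms `m_t` in both
    -- coordinates; adding this difference twice by the Arf property gives `s_{t+1} + m_t`, the
    -- partial sum at the last level.
    rcases hc with ⟨t, rfl⟩ | ⟨g, hg, rfl⟩
    · have l1 := ((h.isMultSeq i).lastLevel_spec t).1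
      have l2 := ((h.isMultSeq j).lastLevel_spec t).1
      dsimp only at hmin
      obtain ⟨a, ha, hai, haj⟩ := diag t (by omega)
      obtain ⟨b, hb, hbi, hbj⟩ := diag (t + 1) (by omega)
      have e : a ⊓ b + (b - a ⊓ b) = b := add_tsub_cancel_of_le inf_le_right
      refine ⟨_, hS.arf _ (hS.inf_mem a ha b hb) (b - a ⊓ b) (b - a ⊓ b) (by rwa [e]) (by rwa [e]),
        ?_, ?_⟩
      · rw [(h.isMultSeq i).partialSum_lastLevel, partialSum_succ]
        rw [partialSum_succ] at hbi
        simp only [Pi.add_apply, Pi.sub_apply, Pi.inf_apply]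
        omega
      · rw [(h.isMultSeq j).partialSum_lastLevel, partialSum_succ]
        rw [partialSum_succ] at hbj
        simp only [Pi.add_apply, Pi.sub_apply, Pi.inf_apply]
        omega
    · exact ⟨g, hG hg, (partialSum_posE_of_mem hE hgcd hg i).symm,
        (partialSum_posE_of_mem hE hgcd hg j).symm⟩
  by_cases hqp : q i = q j ∧ q i ≤ p
  · obtain ⟨w, hw, hwi, hwj⟩ := diag (q i) hqp.2
    exact ⟨w, hw, hwi, by rw [hwj, hqp.1]; rfl⟩
  have hqi : p ≤ q i := by
    have := level q hq p le_rfl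
    omega
  have hqj : p ≤ q j := by
    have := level q hq p le_rfl
    omega
  obtain ⟨w, hw, hwi, hwj⟩ := diag p le_rfl
  obtain ⟨a, -, haS, ea⟩ := lift i (q i)
  obtain ⟨b, -, hbS, eb⟩ := lift j (q j)
  have hai : partialSums E a i = partialSums E q i := by rw [partialSums, partialSums, ea]
  have hbj : partialSums E b j = partialSums E q j := by rw [partialSums, partialSums, eb]
  have hwa : w i ≤ partialSums E a i := by
    rw [hwi, hai]; exact (h.isMultSeq i).strictMono.monotone hqi
  have hwb : w j ≤ partialSums E b j := by
    rw [hwj, hbj]; exact (h.isMultSeq j).strictMono.monotone hqj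
  rw [← hai, ← hbj]
  -- The smaller level of `c` is `p`, so `v` agrees with the diagonal vector `w` there and exceeds
  -- it in the other coordinate.
  rcases hne.lt_or_gt with hlt | hlt
  · have e : c i = p := by omega
    refine hS.exists_mem_pair hw hv haS hbS hij ?_ ?_ hwa hwb
    · rw [hwi, hvi, e]
    · rw [hwj, hvj]; exact (h.isMultSeq j).strictMono (by omega)
  · have e : c j = p := by omega
    obtain ⟨u, hu, huj, hui⟩ := hS.exists_mem_pair (i := j) (j := i) hw hv hbS haS hij.symm
      (by rw [hwj, hvj, e]) (by rw [hwi, hvi]; exact (h.isMultSeq i).strictMono (by omega)) hwb hwa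
    exact ⟨u, hu, hui, huj⟩

theorem isLeast_arfOver (h : IsGluing E (gluingRel E G)) : IsLeast (arfOver G) h.semigroup :=
  ⟨⟨h.isArf_semigroup, subset_semigroup hE hgcd h⟩,
    fun _ hS => semigroup_le_of_isArf hE hgcd h hS.1 hS.2⟩

/-- Last levels are positive, and by locality the position of a vector of `G` is `0` either on all
branches or on none. -/
theorem gluingRel_zero (h : IsGluing E (gluingRel E G))
    (hloc : ∀ g ∈ G, (∃ i, g i = 0) → g = 0) : gluingRel E G 0 = ⊤ := by
  refine Setoid.ext fun i j => iff_of_true ?_ trivial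
  rintro _ (⟨t, rfl⟩ | ⟨g, hg, rfl⟩)
  · have := ((h.isMultSeq i).lastLevel_spec t).1
    have := ((h.isMultSeq j).lastLevel_spec t).1
    dsimp only
    omega
  · have key : ∀ i j, posE E i (g i) = 0 → posE E j (g j) = 0 := by
      intro i j h0
      have hi := partialSum_posE_of_mem hE hgcd hg i
      have hj := partialSum_posE_of_mem hE hgcd hg j
      rw [h0, partialSum_zero] at hi
      rw [hloc g hg ⟨i, hi.symm⟩] at hj ⊢
      exact (h.isMultSeq j).strictMono.injective (hj.trans (partialSum_zero _).symm)
    have := key i j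
    have := key j i
    dsimp only
    omega

end Closure

/-! ### The gluing matrix -/

/-- On `UE E G` the infimum over `G` in `MINE` is over an empty family, hence `⊤`. -/
theorem gluingEntry_eq_MINE (E : Fin n → ℕ → ℕ) (G : Set (Fin n → ℕ)) (i j : Fin n) :
    gluingEntry E G i j = MINE E i j G := by
  rw [gluingEntry]
  split_ifs with hU
  · refine (min_eq_left (le_iInf₂ fun g hg => ?_)).symm
    exact absurd (hU.2 g hg.1) hg.2
  · rfl

/-- Index `t` is level `t + 1`, so the strict inequality says that level `t + 1` is at most the
matrix entry. -/
theorem lt_gluingEntry_iff (E : Fin n → ℕ → ℕ) (G : Set (Fin n → ℕ)) (i j : Fin n) (t : ℕ) :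
    (t : ℕ∞) < gluingEntry E G i j ↔ (gluingRel E G t).r i j := by
  rw [gluingEntry_eq_MINE, ← ENat.add_one_le_iff (ENat.natCast_ne_top t), MINE, le_min_iff, kE]
  simp only [le_iInf_iff]
  constructor
  · rintro ⟨h1, h2⟩ _ (⟨s, rfl⟩ | ⟨g, hg, rfl⟩)
    · rw [or_iff_not_imp_left]
      intro hne
      exact_mod_cast h1 s hne
    · rw [or_iff_not_imp_left]
      intro hne
      exact_mod_cast h2 g ⟨hg, hne⟩
  · intro h
    refine ⟨fun s hne => ?_, fun g hg => ?_⟩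
    · exact_mod_cast (h _ (Or.inl ⟨s, rfl⟩)).resolve_left hne
    · exact_mod_cast (h _ (Or.inr ⟨g, hg.1, rfl⟩)).resolve_left hg.2

theorem iSup_gluingRel (E : Fin n → ℕ → ℕ) (G : Set (Fin n → ℕ)) (i j : Fin n) :
    (⨆ (t : ℕ) (_ : (gluingRel E G t).r i j), ((t + 1 : ℕ) : ℕ∞)) = gluingEntry E G i j := by
  refine le_antisymm (iSup₂_le fun t ht => ?_) (le_of_forall_lt fun c hc => ?_)
  · have := Order.add_one_le_of_lt ((lt_gluingEntry_iff E G i j t).2 ht)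
    exact_mod_cast this
  · lift c to ℕ using (hc.trans_le le_top).ne
    refine lt_of_lt_of_le ?_ (le_iSup₂ (f := fun t _ => ((t + 1 : ℕ) : ℕ∞)) c
      ((lt_gluingEntry_iff E G i j c).1 hc))
    exact_mod_cast Nat.lt_succ_self c

/-! ### The multiplicity tree -/

section Tree

open Classical in
/-- The tree whose branches are glued along the relations `R t` and carry the sequences `m i`. -/
noncomputable def gluedTree (m : Fin n → ℕ → ℕ) (R : ℕ → Setoid (Fin n))
    (hR : ∀ t, R (t + 1) ≤ R t) (h0 : R 0 = ⊤) : BranchTree n where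
  glue := R
  glue_succ_le := hR
  glue_zero := h0
  vec t c h := if Quotient.mk (R t) h = c then m h t else 0

variable {m : Fin n → ℕ → ℕ} {R : ℕ → Setoid (Fin n)} (hR : ∀ t, R (t + 1) ≤ R t) (h0 : R 0 = ⊤)

local notation "𝕋" => gluedTree m R hR h0

open Classical in
theorem gluedTree_val_node (t : ℕ) (i h : Fin n) :
    (𝕋).val ((𝕋).node t i) h = if (R t).r i h then m h t else 0 := by
  have e : Quotient.mk (R t) h = Quotient.mk (R t) i ↔ (R t).r i h :=
    Quotient.eq.trans ⟨(R t).symm, (R t).symm⟩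
  split_ifs with hih
  · exact if_pos (e.2 hih)
  · exact if_neg (mt e.1 hih)

theorem gluedTree_node_eq_iff {s t : ℕ} {i j : Fin n} :
    (𝕋).node s i = (𝕋).node t j ↔ s = t ∧ (R s).r i j := by
  constructor
  · intro e
    obtain rfl : s = t := congrArg Sigma.fst e
    exact ⟨rfl, Quotient.exact (eq_of_heq (Sigma.mk.inj e).2)⟩
  · rintro ⟨rfl, e⟩
    exact congrArg (Sigma.mk s) (Quotient.sound e)

theorem gluedTree_exists_node (x : (𝕋).Node) : ∃ t i, x = (𝕋).node t i := by
  obtain ⟨t, c⟩ := x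
  induction c using Quotient.inductionOn with
  | _ i => exact ⟨t, i, rfl⟩

theorem gluedTree_branch (i : Fin n) : (𝕋).branch i = m i := by
  funext t
  rw [BranchTree.branch, gluedTree_val_node, if_pos ((R t).refl i)]

/-- Only the nodes on the `k`-th branch contribute to the `k`-th coordinate. -/
theorem gluedTree_sum_val (F : Finset (𝕋).Node) (k : Fin n) (a b : ℕ)
    (hF : ∀ u, (𝕋).node u k ∈ F ↔ a ≤ u ∧ u < b) :
    (∑ x ∈ F, (𝕋).val x) k = ∑ u ∈ Finset.Ico a b, m k u := by
  classical
  have hinj : Set.InjOn (fun u => (𝕋).node u k) (Finset.Ico a b : Set ℕ) :=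
    fun s _ t _ e => ((gluedTree_node_eq_iff hR h0).1 e).1
  rw [Finset.sum_apply, ← Finset.sum_subset (s₁ := (Finset.Ico a b).image fun u => (𝕋).node u k),
    Finset.sum_image hinj]
  · refine Finset.sum_congr rfl fun u _ => ?_
    rw [gluedTree_val_node, if_pos ((R u).refl k)]
  · intro x hx
    obtain ⟨u, hu, rfl⟩ := Finset.mem_image.1 hx
    exact (hF u).2 (Finset.mem_Ico.1 hu)
  · intro x hx hxn
    obtain ⟨t, i, rfl⟩ := gluedTree_exists_node hR h0 x
    rw [gluedTree_val_node, if_neg]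
    intro hik
    have e := (gluedTree_node_eq_iff (m := m) hR h0).2 ⟨rfl, hik⟩
    rw [e] at hx hxn
    exact hxn (Finset.mem_image.2 ⟨t, Finset.mem_Ico.2 ((hF t).1 hx), rfl⟩)

include hR in
theorem glue_antitone : Antitone R := antitone_nat_of_succ_le hR

/-- Each branch `k` through the root node of the subtree is cut at `q k`. Compatibility of `q` makes
this well defined on nodes: a node shared by two branches is kept by both or by neither. -/
theorem exists_isSubtree {q : Fin n → ℕ} (hq : q ∈ levelVectors R) (t : ℕ) (i : Fin n)
    (hi : t < q i) : ∃ F : Finset (𝕋).Node, (𝕋).IsSubtree F t i ∧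
      ∀ u k, (𝕋).node u k ∈ F ↔ t ≤ u ∧ u < q k ∧ (R t).r i k := by
  classical
  have hF : ∃ F : Finset (𝕋).Node, ∀ u k, (𝕋).node u k ∈ F ↔ t ≤ u ∧ u < q k ∧ (R t).r i k := by
    refine ⟨(Finset.univ.filter fun k => (R t).r i k).biUnion fun k =>
      (Finset.Ico t (q k)).image fun u => (𝕋).node u k, fun u k => ?_⟩
    simp only [Finset.mem_biUnion, Finset.mem_filter, Finset.mem_univ, true_and, Finset.mem_image,
      Finset.mem_Ico]
    constructor
    · rintro ⟨h, hih, s, hs, e⟩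
      obtain ⟨rfl, hhk⟩ := (gluedTree_node_eq_iff hR h0).1 e
      have := hq s h k hhk
      exact ⟨hs.1, by omega, (R t).trans hih (glue_antitone hR hs.1 hhk)⟩
    · rintro ⟨h1, h2, h3⟩
      exact ⟨k, h3, u, ⟨h1, h2⟩, rfl⟩
  obtain ⟨F, hF⟩ := hF
  refine ⟨F, ⟨?_, ?_, ?_⟩, hF⟩
  · exact (hF t i).2 ⟨le_rfl, hi, (R t).refl i⟩
  · intro s h hs
    have := (hF s h).1 hs
    exact ⟨this.1, this.2.2⟩
  · intro s h hts hs
    have := (hF (s + 1) h).1 hs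
    exact (hF s h).2 ⟨hts, by omega, this.2.2⟩

theorem isMultiplicityTree_gluedTree (h : IsGluing m R) : (𝕋).IsMultiplicityTree where
  eventually_unit := by
    classical
    obtain ⟨L, hL⟩ := h.separated
    obtain ⟨M, hM⟩ : ∃ M, ∀ t, M ≤ t → ∀ i, m i t = 1 := by
      rw [← Filter.eventually_atTop, Filter.eventually_all]
      exact fun i => Filter.eventually_atTop.2 (h.isMultSeq i).eventually_one
    refine ⟨max L M, fun t ht i => funext fun k => ?_⟩
    rw [gluedTree_val_node, hM t (by omega)]
    rcases eq_or_ne i k with rfl | hik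
    · rw [if_pos ((R t).refl i), Pi.single_eq_same]
    · rw [if_neg fun e => hik (hL t (by omega) i k e), Pi.single_eq_of_ne hik.symm]
  zero_iff t i k := by
    classical
    rw [gluedTree_val_node]
    have := (h.isMultSeq k).pos t
    change _ ↔ ¬ (R t).r i k
    split_ifs with hik
    · exact iff_of_false this.ne' (not_not.2 hik)
    · exact iff_of_true rfl hik
  sum_subtree t i := by
    classical
    -- Cutting at the last levels turns the identities `m_t = m_{t+1} + ... + m_s` of all branches
    -- into one sum over a subtree.
    obtain ⟨F, hF, hmem⟩ := exists_isSubtree (m := m) hR h0 (h.lastLevel_mem t) t i (by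
      have := ((h.isMultSeq i).lastLevel_spec t).1
      omega)
    refine ⟨F, hF, funext fun k => ?_⟩
    rw [gluedTree_val_node]
    split_ifs with hik
    · rw [((h.isMultSeq k).lastLevel_spec t).2]
      symm
      refine gluedTree_sum_val hR h0 _ k _ _ fun u => ?_
      rw [Finset.mem_erase, Ne, gluedTree_node_eq_iff, hmem]
      constructor
      · rintro ⟨h1, h2, h3, -⟩
        refine ⟨?_, h3⟩
        by_contra! hlt
        obtain rfl : u = t := by omega
        exact h1 ⟨rfl, (R u).symm hik⟩
      · rintro ⟨h1, h2⟩
        exact ⟨fun e => by omega, by omega, h2, hik⟩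
    · rw [gluedTree_sum_val hR h0 _ k 0 0 fun u => ?_, Finset.Ico_self, Finset.sum_empty]
      rw [Finset.mem_erase, hmem]
      exact iff_of_false (fun e => hik e.2.2.2) (by omega)

theorem semigroup_eq_gluedTree_semigroup (h : IsGluing m R) :
    (h.semigroup : Set (Fin n → ℕ)) = (𝕋).semigroup := by
  classical
  have htop : ∀ i k, (R 0).r i k := fun i k => by rw [h0]; trivial
  ext x
  constructor
  · rintro ⟨q, hq, rfl⟩
    by_cases hx : partialSums m q = 0
    · exact Or.inl hx
    · obtain ⟨i, hi⟩ : ∃ i, partialSums m q i ≠ 0 := Function.ne_iff.1 hx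
      have hqi : 0 < q i := Nat.pos_of_ne_zero fun e => hi (by rw [partialSums, e, partialSum_zero])
      obtain ⟨F, hF, hmem⟩ := exists_isSubtree (m := m) hR h0 hq 0 i hqi
      refine Or.inr ⟨F, i, hF, funext fun k => ?_⟩
      rw [gluedTree_sum_val hR h0 F k 0 (q k) fun u => ?_, partialSums, partialSum,
        Finset.range_eq_Ico]
      rw [hmem]
      exact ⟨fun e => ⟨e.1, e.2.1⟩, fun e => ⟨e.1, e.2, htop i k⟩⟩
  · rintro (rfl | ⟨F, i, hF, rfl⟩)
    · exact h.semigroup.zero_mem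
    -- A finite set closed under parents meets each branch in an initial segment; `b` is the first
    -- missing level.
    · have hq : ∀ k, ∃ b, ∀ u, (𝕋).node u k ∈ F ↔ 0 ≤ u ∧ u < b := by
        intro k
        have hex : ∃ b, (𝕋).node b k ∉ F := by
          by_contra! hall
          refine Set.infinite_of_injective_forall_mem (f := fun u => (𝕋).node u k)
            (fun s t e => ((gluedTree_node_eq_iff hR h0).1 e).1) (s := (F : Set (𝕋).Node))
            (fun u => hall u) F.finite_toSet
        refine ⟨Nat.find hex, fun u => ⟨fun hu => ⟨Nat.zero_le _, ?_⟩, fun hu => ?_⟩⟩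
        · by_contra! hle
          have : ∀ d, (𝕋).node (Nat.find hex + d) k ∈ F → (𝕋).node (Nat.find hex) k ∈ F := by
            intro d
            induction d with
            | zero => exact id
            | succ d ih => exact fun hd => ih (hF.parent_mem _ _ (Nat.zero_le _) hd)
          obtain ⟨d, rfl⟩ := Nat.exists_eq_add_of_le hle
          exact Nat.find_spec hex (this d hu)
        · exact not_not.1 (Nat.find_min hex hu.2)
      choose q hq using hq
      refine ⟨q, fun t j k hjk => ?_, funext fun k => ?_⟩
      -- If branch `j` is left at `q j ≤ t`, the first missing node is also on branch `k`, so `k`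
      -- cannot continue past it.
      · have key : ∀ j k, (R t).r j k → q j ≤ t → q k ≤ q j := by
          intro j k hjk hj
          by_contra! hlt
          have h1 := (hq k (q j)).2 ⟨Nat.zero_le _, hlt⟩
          have e := (gluedTree_node_eq_iff (m := m) hR h0).2 ⟨rfl, glue_antitone hR hj hjk⟩
          rw [← e, hq j] at h1
          omega
        have h1 := key j k hjk
        have h2 := key k j ((R t).symm hjk)
        omega
      · rw [gluedTree_sum_val hR h0 F k 0 (q k) (hq k), partialSums, partialSum,
          Finset.range_eq_Ico]

end Tree

/-! ### Necessity of the conditions -/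

section Necessity

/-- The positive vectors of `S`, together with zero. -/
def localization (S : AddSubmonoid (Fin n → ℕ)) : AddSubmonoid (Fin n → ℕ) where
  carrier := {x | x ∈ S ∧ ((∃ i, x i = 0) → x = 0)}
  zero_mem' := ⟨S.zero_mem, fun _ => rfl⟩
  add_mem' := by
    rintro a b ⟨ha, ha'⟩ ⟨hb, hb'⟩
    refine ⟨S.add_mem ha hb, fun ⟨i, hi⟩ => ?_⟩
    have hi : a i + b i = 0 := hi
    rw [ha' ⟨i, by omega⟩, hb' ⟨i, by omega⟩, add_zero]

theorem localization_le (S : AddSubmonoid (Fin n → ℕ)) : localization S ≤ S := fun _ hx => hx.1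

theorem isLocalSemigroup_localization (S : AddSubmonoid (Fin n → ℕ)) :
    IsLocalSemigroup (localization S) := fun _ hx => hx.2

theorem IsArf.localization {S : AddSubmonoid (Fin n → ℕ)} (hS : IsArf S) :
    IsArf (localization S) where
  inf_mem := by
    rintro a ⟨ha, ha'⟩ b ⟨hb, hb'⟩
    refine ⟨hS.inf_mem a ha b hb, fun ⟨i, hi⟩ => ?_⟩
    have hi : min (a i) (b i) = 0 := hi
    rcases (by omega : a i = 0 ∨ b i = 0) with h | h
    · rw [ha' ⟨i, h⟩]; funext k; exact Nat.zero_min _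
    · rw [hb' ⟨i, h⟩]; funext k; exact Nat.min_zero _
  exchange := by
    rintro a ⟨ha, ha'⟩ b ⟨hb, hb'⟩ i hi
    -- A zero coordinate makes `a` or `b` zero, and the common coordinate `i` then makes both zero;
    -- any positive vector of `S` will do. Otherwise the exchange vector of `S` is itself positive.
    by_cases h : ∃ k, min (a k) (b k) = 0
    · obtain ⟨δ, hδ, hδS⟩ := hS.conductor
      have hab : a = b := by
        have key : ∀ a b : Fin n → ℕ, (∀ k, a k = 0 → a = 0) → (∀ k, b k = 0 → b = 0) → a i = b i →
            ∀ k, a k = 0 → a = b := by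
          intro a b ha hb hi k hk
          rw [ha k hk] at hi ⊢
          exact (hb i hi.symm).symm
        obtain ⟨k, hk⟩ := h
        rcases (by omega : a k = 0 ∨ b k = 0) with h | h
        · exact key a b (fun k hk => ha' ⟨k, hk⟩) (fun k hk => hb' ⟨k, hk⟩) hi k h
        · exact (key b a (fun k hk => hb' ⟨k, hk⟩) (fun k hk => ha' ⟨k, hk⟩) hi.symm k h).symm
      subst hab
      refine ⟨δ + (fun k => a k + 1), ⟨hδS _, fun ⟨k, hk⟩ => ?_⟩, ?_, fun j _ => ⟨?_, ?_⟩⟩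
      · have hk : δ k + (a k + 1) = 0 := hk
        omega
      · simp only [Pi.add_apply]; omega
      · simp only [Pi.add_apply]; omega
      · exact fun h => absurd rfl h
    · obtain ⟨c, hc, h1, h2⟩ := hS.exchange a ha b hb i hi
      refine ⟨c, ⟨hc, fun ⟨k, hk⟩ => absurd ⟨k, ?_⟩ h⟩, h1, h2⟩
      rcases eq_or_ne k i with rfl | hki
      · omega
      · have := (h2 k hki).1
        omega
  conductor := by
    obtain ⟨δ, hδ, hδS⟩ := hS.conductor
    have key : ∀ x, δ + 1 + x ∈ _root_.localization S := fun x =>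
      ⟨by rw [add_assoc]; exact hδS _, fun ⟨k, hk⟩ => by
        have hk : δ k + 1 + x k = 0 := hk
        omega⟩
    exact ⟨δ + 1, by simpa using key 0, key⟩
  arf := by
    rintro α ⟨hα, hα'⟩ x y ⟨hx, hx'⟩ ⟨hy, hy'⟩
    refine ⟨hS.arf α hα x y hx hy, fun ⟨i, hi⟩ => ?_⟩
    have hi : α i + (x i + y i) = 0 := hi
    have e1 := hx' ⟨i, show α i + x i = 0 by omega⟩
    have e2 := hy' ⟨i, show α i + y i = 0 by omega⟩
    rw [← add_assoc, e1, zero_add]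
    funext k
    have : α k + y k = 0 := congrFun e2 k
    change y k = 0
    omega

/-- The vectors whose `i`-th coordinate is a multiple of `d` or at least `M`. -/
def dvdOrLarge (i : Fin n) (d M : ℕ) : AddSubmonoid (Fin n → ℕ) where
  carrier := {x | d ∣ x i ∨ M ≤ x i}
  zero_mem' := Or.inl (dvd_zero d)
  add_mem' := by
    rintro a b (ha | ha) (hb | hb)
    · exact Or.inl (dvd_add ha hb)
    all_goals
      right
      simp only [Pi.add_apply]
      omega

theorem isArf_dvdOrLarge (i : Fin n) (d M : ℕ) : IsArf (dvdOrLarge i d M) where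
  inf_mem a ha b hb := by
    change d ∣ min (a i) (b i) ∨ M ≤ min (a i) (b i)
    rcases le_total (a i) (b i) with h | h
    · rw [min_eq_left h]; exact ha
    · rw [min_eq_right h]; exact hb
  exchange a ha b hb j hj := by
    refine ⟨fun k => min (a k) (b k) + if a k = b k then d + M + 1 else 0, ?_, ?_, fun k _ => ⟨?_, ?_⟩⟩
    · change d ∣ min (a i) (b i) + _ ∨ M ≤ min (a i) (b i) + _
      split_ifs with h
      · right; omega
      · rcases le_total (a i) (b i) with h | h
        · rw [min_eq_left h]; exact ha
        · rw [min_eq_right h]; exact hb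
    · dsimp only
      rw [if_pos hj]; omega
    · exact Nat.le_add_right _ _
    · intro h
      dsimp only
      rw [if_neg h, add_zero]
  conductor := ⟨fun _ => M, Or.inr le_rfl, fun x => Or.inr (Nat.le_add_right _ _)⟩
  arf α hα x y hx hy := by
    change d ∣ α i + (x i + y i) ∨ M ≤ α i + (x i + y i)
    change d ∣ α i ∨ M ≤ α i at hα
    change d ∣ α i + x i ∨ M ≤ α i + x i at hx
    change d ∣ α i + y i ∨ M ≤ α i + y i at hy
    by_cases hM : M ≤ α i + (x i + y i)
    · exact Or.inr hM
    · have hα := hα.resolve_right (by omega)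
      have hx := hx.resolve_right (by omega)
      have hy := hy.resolve_right (by omega)
      exact Or.inl (dvd_add hα (dvd_add ((Nat.dvd_add_right hα).1 hx) ((Nat.dvd_add_right hα).1 hy)))

/-- The vectors whose coordinates `i` and `j` are equal or both at least `M`. -/
def eqOrLarge (i j : Fin n) (M : ℕ) : AddSubmonoid (Fin n → ℕ) where
  carrier := {x | x i = x j ∨ M ≤ min (x i) (x j)}
  zero_mem' := Or.inl rfl
  add_mem' {a b} ha hb := by
    simp only [Set.mem_ofPred_eq, Pi.add_apply] at *
    omega

theorem mem_eqOrLarge {i j : Fin n} {M : ℕ} {x : Fin n → ℕ} :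
    x ∈ eqOrLarge i j M ↔ x i = x j ∨ M ≤ min (x i) (x j) := Iff.rfl

theorem isArf_eqOrLarge (i j : Fin n) (M : ℕ) : IsArf (eqOrLarge i j M) where
  inf_mem a ha b hb := by
    simp only [mem_eqOrLarge, Pi.inf_apply] at *
    omega
  exchange a ha b hb k hk := by
    refine ⟨fun l => min (a l) (b l) + if a l = b l then 1 else 0, ?_, ?_, fun l _ => ⟨?_, ?_⟩⟩
    · simp only [mem_eqOrLarge] at *
      split_ifs <;> omega
    · dsimp only
      rw [if_pos hk]; omega
    · exact Nat.le_add_right _ _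
    · intro h
      dsimp only
      rw [if_neg h, add_zero]
  conductor := ⟨fun _ => M, Or.inl rfl, fun x => by
    simp only [mem_eqOrLarge, Pi.add_apply]
    omega⟩
  arf α hα x y hx hy := by
    simp only [mem_eqOrLarge, Pi.add_apply] at *
    omega

/-- The threshold in `dvdOrLarge` may be taken above any given vector, so the gcd divides the `i`-th
coordinate of every vector of `S`, in particular those of `δ` and `δ + 1`. Likewise `δ` and `δ +
e_i` cannot both have equal coordinates `i` and `j`. -/
theorem condition_of_lower_bound {G : Set (Fin n → ℕ)} {S : AddSubmonoid (Fin n → ℕ)}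
    (hS : IsArf S) (hle : ∀ S', IsArf S' → G ⊆ (S' : Set (Fin n → ℕ)) → S ≤ S') :
    (∀ i, Nat.setGcd (coords G i) = 1) ∧ ∀ i j, i < j → ∃ g ∈ G, g i ≠ g j := by
  obtain ⟨δ, hδ, hδS⟩ := hS.conductor
  constructor
  · intro i
    have key : ∀ x ∈ S, Nat.setGcd (coords G i) ∣ x i := fun x hx =>
      (hle _ (isArf_dvdOrLarge i (Nat.setGcd (coords G i)) (x i + 1))
        (fun g hg => Or.inl (Nat.setGcd_dvd_of_mem ⟨g, hg, rfl⟩)) hx).resolve_right (by omega)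
    have h1 := key _ hδ
    have h2 := key _ (hδS fun _ => 1)
    exact Nat.dvd_one.1 ((Nat.dvd_add_right h1).1 h2)
  · intro i j hij
    by_contra! hG
    -- The threshold exceeds the coordinates `i` and `j` of both `δ` and `δ + e_i`, so only the
    -- equality alternative remains.
    have h := hle _ (isArf_eqOrLarge i j (δ i + δ j + 2)) (fun g hg => Or.inl (hG g hg))
    have h1 := mem_eqOrLarge.1 (h hδ)
    have h2 := mem_eqOrLarge.1 (h (hδS (Pi.single i 1)))
    simp only [Pi.add_apply, Pi.single_eq_same, Pi.single_eq_of_ne hij.ne'] at h2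
    omega

end Necessity

/-- Existence criterion for the Arf closure of a set of vectors of `ℕⁿ`, among all Arf semigroups
and, when no nonzero vector of `G` has a zero coordinate (which is necessary for a local semigroup
to contain `G`), among the local ones; in the latter case, its explicit computation. -/
theorem mainTheorem1 (n : ℕ) (G : Set (Fin n → ℕ)) :
    ((∃ S, IsLeast (arfOver G) S) ↔
      (∀ i, Nat.setGcd (coords G i) = 1) ∧ ∀ i j, i < j → ∃ g ∈ G, g i ≠ g j) ∧
    ((∀ g ∈ G, (∃ i, g i = 0) → g = 0) →
      ((∃ S, IsLeast (localArfOver G) S) ↔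
        (∀ i, Nat.setGcd (coords G i) = 1) ∧ ∀ i j, i < j → ∃ g ∈ G, g i ≠ g j) ∧
      ((∀ i, Nat.setGcd (coords G i) = 1) → (∀ i j, i < j → ∃ g ∈ G, g i ≠ g j) →
        ∃ E : Fin n → ℕ → ℕ,
          (∀ i, E i = duVal (coords G i)) ∧
          (∀ i, ∃ A : AddSubmonoid ℕ,
            IsLeast {B : AddSubmonoid ℕ | IsArfNumerical B ∧ coords G i ⊆ (B : Set ℕ)} A ∧
            multSeq A = E i) ∧
          ∃ T : BranchTree n, T.IsMultiplicityTree ∧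
            (∀ i, T.branch i = E i) ∧
            (∀ i j, i < j → T.gluingLevel i j = gluingEntry E G i j ∧ gluingEntry E G i j ≠ ⊤) ∧
            ∃ S : AddSubmonoid (Fin n → ℕ), (S : Set (Fin n → ℕ)) = T.semigroup ∧
              IsLeast (localArfOver G) S ∧ IsLeast (arfOver G) S)) := by
  have hE : ∀ i, (fun i => duVal (coords G i)) i = duVal (coords G i) := fun _ => rfl
  have localLeast : ∀ S, IsLeast (arfOver G) S → IsLocalSemigroup S →
      IsLeast (localArfOver G) S := fun S hS hloc =>
    ⟨⟨hS.1.1, hloc, hS.1.2⟩, fun _ hS' => hS.2 ⟨hS'.1, hS'.2.2⟩⟩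
  refine ⟨⟨?_, ?_⟩, fun hloc => ⟨⟨?_, ?_⟩, ?_⟩⟩
  · rintro ⟨S, hS, hle⟩
    exact condition_of_lower_bound hS.1 fun S' hS' hG => hle ⟨hS', hG⟩
  · rintro ⟨hgcd, hsep⟩
    exact ⟨_, isLeast_arfOver hE hgcd (isGluing_gluingRel hE hgcd hsep)⟩
  · rintro ⟨S, hS, hle⟩
    -- The localization of any Arf semigroup over `G` still contains `G`, so the least local one
    -- lies below every Arf semigroup over `G`.
    refine condition_of_lower_bound hS.1 fun S' hS' hG => le_trans (hle ?_) (localization_le S')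
    exact ⟨hS'.localization, isLocalSemigroup_localization S', fun g hg => ⟨hG hg, hloc g hg⟩⟩
  · rintro ⟨hgcd, hsep⟩
    have h := isGluing_gluingRel hE hgcd hsep
    exact ⟨_, localLeast _ (isLeast_arfOver hE hgcd h)
      (h.isLocalSemigroup_semigroup (gluingRel_zero hE hgcd h hloc))⟩
  · intro hgcd hsep
    have h := isGluing_gluingRel hE hgcd hsep
    have h0 := gluingRel_zero hE hgcd h hloc
    have hR := fun t => gluingRel_anti (fun i => duVal (coords G i)) G (Nat.le_succ t)
    refine ⟨_, hE, fun i => ⟨_, isLeast_toSubmonoid_duVal (hgcd i),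
      (isMultSeq_duVal (hgcd i)).multSeq_toSubmonoid⟩, gluedTree _ _ hR h0,
      isMultiplicityTree_gluedTree hR h0 h, gluedTree_branch hR h0,
      fun i j hij => ⟨iSup_gluingRel _ G i j, fun htop => ?_⟩,
      h.semigroup, semigroup_eq_gluedTree_semigroup hR h0 h,
      localLeast _ (isLeast_arfOver hE hgcd h) (h.isLocalSemigroup_semigroup h0),
      isLeast_arfOver hE hgcd h⟩
    obtain ⟨t, ht⟩ := exists_not_gluingRel hE hgcd (hsep i j hij)
    rw [← lt_gluingEntry_iff, htop] at ht
    exact ht (ENat.natCast_lt_top t)
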